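/- Let $n \ge 1$, let $\mathbb{D}^n = \{z \in \mathbb{C}^n : |z_j| < 1 \text{ for all } j\}$ be the unit polydisc, and let $A^2(\mathbb{D}^n)$ be its Bergman space: the Hilbert space of holomorphic functions on $\mathbb{D}^n$ that are square integrable with respect to Lebesgue measure, with the inner product of $L^2(\mathbb{D}^n)$. Let $a_1,\dots,a_n \in \mathbb{C}$, put $\phi(z) = \sum_{j=1}^n a_j z_j$ and $S_a = \sum_{j=1}^n |a_j|^2$, let $T_\phi : A^2(\mathbb{D}^n) \to A^2(\mathbb{D}^n)$ be the operator $T_\phi f = \phi f$, and let $[T_\phi^*,T_\phi] = T_\phi^* T_\phi - T_\phi T_\phi^*$ be its self-commutator. Then the spectrum of $T_\phi$ is the closed disc $$\Big\{\mu \in \mathbb{C} : |\mu| \le \sum_{j=1}^n |a_j|\Big\},$$ and, in operator norm, $$\frac{3^{n-1}}{2^{2n-1}}\, S_a \;\le\; \big\|[T_\phi^*,T_\phi]\big\| \;\le\; \Big(\sum_{j=1}^n |a_j|\Big)^2 \;\le\; n\, S_a .$$ -/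

import Mathlib

open MeasureTheory Filter Topology Metric
open scoped ENNReal

noncomputable section

/-- The Bergman space `A²(Ω)` of a set `Ω ⊆ ℂⁿ`, as a subspace of `L²(Ω)` (Lebesgue measure):
the classes that have a representative holomorphic on `Ω`. -/
def bergmanSpace {n : ℕ} (Ω : Set (Fin n → ℂ)) :
    Submodule ℂ (Lp ℂ 2 ((volume : Measure (Fin n → ℂ)).restrict Ω)) where
  carrier := {f | ∃ g : (Fin n → ℂ) → ℂ, DifferentiableOn ℂ g Ω ∧ f =ᵐ[volume.restrict Ω] g}
  add_mem' := by
    rintro f₁ f₂ ⟨g₁, h₁, e₁⟩ ⟨g₂, h₂, e₂⟩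
    exact ⟨g₁ + g₂, h₁.add h₂, (Lp.coeFn_add f₁ f₂).trans (e₁.add e₂)⟩
  zero_mem' := ⟨0, differentiableOn_const 0, Lp.coeFn_zero _ _ _⟩
  smul_mem' := by
    rintro c f ⟨g, h, e⟩
    exact ⟨c • g, h.const_smul c, (Lp.coeFn_smul c f).trans (e.const_smul c)⟩

/-! Completeness of the Bergman space, needed for adjoints on it. -/

theorem measurePreserving_rot (n : ℕ) (c : ℂ) (hc : ‖c‖ = 1) :
    MeasurePreserving (fun v : Fin n → ℂ => c • v) volume volume := by
  have h1 : MeasurePreserving (fun z : ℂ => c * z) volume volume :=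
    (rotation ⟨c, mem_sphere_zero_iff_norm.2 hc⟩).measurePreserving
  exact volume_preserving_pi (fun _ : Fin n => h1)

theorem mean_value_le {n : ℕ} {g : (Fin n → ℂ) → ℂ} {w : Fin n → ℂ} {r : ℝ}
    (hg : DifferentiableOn ℂ g (ball w r)) :
    ‖g w‖ₑ * volume (ball (0 : Fin n → ℂ) r) ≤ ∫⁻ v in ball w r, ‖g v‖ₑ := by
  set G : (Fin n → ℂ) → ℂ := (ball w r).indicator g with hG
  have hGm : Measurable G := by
    classical
    have := hg.continuousOn.measurable_piecewise (g := fun _ => (0 : ℂ))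
      continuousOn_const measurableSet_ball
    rw [hG, ← Set.piecewise_eq_indicator]
    exact this
  set ν : Measure ℝ := volume.restrict (Set.Ioc 0 (2 * Real.pi)) with hν
  have hνu : ν Set.univ = ENNReal.ofReal (2 * Real.pi) := by simp [hν]
  have key : ∀ v ∈ ball (0 : Fin n → ℂ) r,
      ‖g w‖ₑ * ENNReal.ofReal (2 * Real.pi) ≤ ∫⁻ θ, ‖G (w + circleMap 0 1 θ • v)‖ₑ ∂ν := by
    intro v hv
    have hin : ∀ ζ : ℂ, ‖ζ‖ ≤ 1 → w + ζ • v ∈ ball w r := by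
      intro ζ hζ
      rw [mem_ball_zero_iff] at hv
      rw [mem_ball, dist_eq_norm, add_sub_cancel_left, norm_smul]
      nlinarith [norm_nonneg v]
    have hd : DifferentiableOn ℂ (fun ζ : ℂ => g (w + ζ • v)) (closedBall 0 1) := by
      refine hg.comp (by fun_prop) ?_
      intro ζ hζ
      exact hin ζ (by simpa using hζ)
    have hm : Real.circleAverage (fun ζ : ℂ => g (w + ζ • v)) 0 1 = g w := by
      have : DiffContOnCl ℂ (fun ζ : ℂ => g (w + ζ • v)) (ball 0 |1|) := by
        refine DifferentiableOn.diffContOnCl ?_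
        simpa [closure_ball] using hd
      simpa using this.circleAverage
    have hm2 : ∫ θ, g (w + circleMap 0 1 θ • v) ∂ν = (2 * Real.pi : ℝ) • g w := by
      rw [← hm, Real.circleAverage_def, smul_inv_smul₀ (by positivity),
        intervalIntegral.integral_of_le (by positivity)]
    calc ‖g w‖ₑ * ENNReal.ofReal (2 * Real.pi)
        = ‖(2 * Real.pi : ℝ) • g w‖ₑ := by
          rw [enorm_smul, mul_comm, Real.enorm_of_nonneg (by positivity)]
      _ ≤ ∫⁻ θ, ‖g (w + circleMap 0 1 θ • v)‖ₑ ∂ν := by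
          rw [← hm2]; exact enorm_integral_le_lintegral_enorm _
      _ = _ := by
          refine lintegral_congr fun θ => ?_
          rw [hG, Set.indicator_of_mem (hin _ (by simp))]
  have hrot : ∀ θ : ℝ, ∫⁻ v, ‖G (w + circleMap 0 1 θ • v)‖ₑ = ∫⁻ v in ball w r, ‖g v‖ₑ := by
    intro θ
    have h1 := (measurePreserving_rot n (circleMap 0 1 θ) (by simp)).lintegral_comp
      (f := fun u : Fin n → ℂ => ‖G (w + u)‖ₑ) (by fun_prop)
    rw [h1, lintegral_add_left_eq_self (fun u => ‖G u‖ₑ) w, ← lintegral_indicator measurableSet_ball]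
    refine lintegral_congr fun v => ?_
    by_cases hv : v ∈ ball w r <;> simp [hG, hv]
  have hfin : ENNReal.ofReal (2 * Real.pi) ≠ 0 := by simp [Real.pi_pos]
  rw [← ENNReal.mul_le_mul_iff_left hfin ENNReal.ofReal_ne_top]
  calc ‖g w‖ₑ * volume (ball (0 : Fin n → ℂ) r) * ENNReal.ofReal (2 * Real.pi)
      = ∫⁻ v in ball (0 : Fin n → ℂ) r, ‖g w‖ₑ * ENNReal.ofReal (2 * Real.pi) := by
        rw [setLIntegral_const]; ring
    _ ≤ ∫⁻ v in ball (0 : Fin n → ℂ) r, ∫⁻ θ, ‖G (w + circleMap 0 1 θ • v)‖ₑ ∂ν :=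
        setLIntegral_mono' measurableSet_ball key
    _ ≤ ∫⁻ v, ∫⁻ θ, ‖G (w + circleMap 0 1 θ • v)‖ₑ ∂ν := setLIntegral_le_lintegral _ _
    _ = ∫⁻ θ, (∫⁻ v, ‖G (w + circleMap 0 1 θ • v)‖ₑ) ∂ν := by
        refine lintegral_lintegral_swap ?_
        have : Measurable fun p : (Fin n → ℂ) × ℝ => w + circleMap 0 1 p.2 • p.1 := by
          refine Continuous.measurable ?_
          have := continuous_circleMap 0 1
          fun_prop
        exact (hGm.comp this).enorm.aemeasurable
    _ = _ := by
        simp_rw [hrot]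
        rw [lintegral_const, hνu]

theorem point_bound {n : ℕ} (Ω : Set (Fin n → ℂ)) {r : ℝ} (hr : 0 < r) :
    ∃ C : ℝ, 0 ≤ C ∧ ∀ (F : Lp ℂ 2 ((volume : Measure (Fin n → ℂ)).restrict Ω))
      (g : (Fin n → ℂ) → ℂ), DifferentiableOn ℂ g Ω → F =ᵐ[volume.restrict Ω] g →
      ∀ w, ball w r ⊆ Ω → ‖g w‖ ≤ C * ‖F‖ := by
  set V : ℝ≥0∞ := volume (ball (0 : Fin n → ℂ) r) with hV
  have hV0 : V ≠ 0 := (measure_ball_pos _ _ hr).ne'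
  have hVt : V ≠ ∞ := measure_ball_lt_top.ne
  set K : ℝ≥0∞ := V ^ (1 / (1 : ℝ≥0∞).toReal - 1 / (2 : ℝ≥0∞).toReal) / V with hK
  have hKt : K ≠ ∞ := ENNReal.div_ne_top (ENNReal.rpow_ne_top_of_ne_zero hV0 hVt) hV0
  refine ⟨K.toReal, ENNReal.toReal_nonneg, fun F g hg hF w hw => ?_⟩
  have h1 := mean_value_le (hg.mono hw)
  have hVw : (volume.restrict (ball w r)) Set.univ = V := by
    rw [Measure.restrict_apply_univ, hV, Measure.addHaar_ball_center]
  have hF' : F =ᵐ[volume.restrict (ball w r)] g :=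
    ae_restrict_of_ae_restrict_of_subset hw hF
  have h2 : ∫⁻ v in ball w r, ‖g v‖ₑ ≤
      eLpNorm F 2 (volume.restrict Ω) * V ^ (1 / (1 : ℝ≥0∞).toReal - 1 / (2 : ℝ≥0∞).toReal) := by
    rw [← eLpNorm_one_eq_lintegral_enorm, ← eLpNorm_congr_ae hF', ← hVw]
    have hmono : (volume : Measure (Fin n → ℂ)).restrict (ball w r) ≤ volume.restrict Ω :=
      Measure.restrict_mono hw le_rfl
    refine (eLpNorm_le_eLpNorm_mul_rpow_measure_univ (p := 1) (q := 2) (by norm_num)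
      ((Lp.aestronglyMeasurable F).mono_measure hmono)).trans ?_
    gcongr
  have h3 : ‖g w‖ₑ ≤ K * eLpNorm F 2 (volume.restrict Ω) := by
    rw [hK, ENNReal.mul_comm_div, ← mul_div_assoc, mul_comm, ENNReal.le_div_iff_mul_le (.inl hV0) (.inl hVt)]
    exact h1.trans (by rw [mul_comm]; simpa [mul_comm] using h2)
  have := ENNReal.toReal_mono (ENNReal.mul_ne_top hKt (Lp.eLpNorm_ne_top F)) h3
  simpa [Lp.norm_def] using this

theorem isClosed_bergmanSpace {n : ℕ} {Ω : Set (Fin n → ℂ)} (hΩ : IsOpen Ω) :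
    IsClosed (bergmanSpace Ω : Set (Lp ℂ 2 ((volume : Measure (Fin n → ℂ)).restrict Ω))) := by
  refine isClosed_of_closure_subset fun f hf => ?_
  obtain ⟨F, hFm, hFf⟩ := mem_closure_iff_seq_limit.1 hf
  choose g hg hFg using hFm
  have hsub : ∀ k m, (F k - F m : Lp ℂ 2 ((volume : Measure (Fin n → ℂ)).restrict Ω))
      =ᵐ[volume.restrict Ω] (g k - g m) := fun k m =>
    (Lp.coeFn_sub _ _).trans ((hFg k).sub (hFg m))
  have hFc := Metric.cauchySeq_iff.1 hFf.cauchySeq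
  -- locally uniform Cauchy estimates for the functions and their derivatives
  have hbd : ∀ z ∈ Ω, ∃ s > 0, ball z s ⊆ Ω ∧
      UniformCauchySeqOn g atTop (ball z s) ∧
      UniformCauchySeqOn (fun k => fderiv ℂ (g k)) atTop (ball z s) := by
    intro z hz
    obtain ⟨ρ, hρ, hρΩ⟩ := Metric.isOpen_iff.1 hΩ z hz
    obtain ⟨C, hC0, hC⟩ := point_bound Ω (r := ρ / 4) (by positivity)
    have hin : ∀ w ∈ ball z (ρ / 2), ball w (ρ / 4) ⊆ Ω := fun w hw =>
      (ball_subset_ball' (by rw [mem_ball] at hw; linarith)).trans hρΩ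
    have hval : ∀ k m, ∀ w ∈ ball z (ρ / 2), ‖g k w - g m w‖ ≤ C * ‖F k - F m‖ :=
      fun k m w hw => hC _ (g k - g m) ((hg k).sub (hg m)) (hsub k m) w (hin w hw)
    have hder : ∀ k m, ∀ w ∈ ball z (ρ / 4),
        ‖fderiv ℂ (g k) w - fderiv ℂ (g m) w‖ ≤ 2 * (C * ‖F k - F m‖) / (ρ / 4) := by
      intro k m w hw
      have hw2 : ball w (ρ / 4) ⊆ ball z (ρ / 2) :=
        ball_subset_ball' (by rw [mem_ball] at hw; linarith)
      have hwin : w ∈ ball w (ρ / 4) := mem_ball_self (by positivity)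
      have hwΩ : ball w (ρ / 4) ⊆ Ω :=
        hw2.trans ((ball_subset_ball (by linarith)).trans hρΩ)
      have hnhds : Ω ∈ 𝓝 w := hΩ.mem_nhds (hwΩ hwin)
      rw [← fderiv_sub ((hg k).differentiableAt hnhds) ((hg m).differentiableAt hnhds)]
      refine Complex.norm_fderiv_le_div_of_mapsTo_ball (((hg k).sub (hg m)).mono hwΩ) ?_
        (by positivity)
      intro v hv
      rw [mem_closedBall, dist_eq_norm]
      refine (norm_sub_le _ _).trans ?_
      have h1 := hval k m v (hw2 hv)
      have h2 := hval k m w (hw2 hwin)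
      simp only [Pi.sub_apply]
      linarith
    refine ⟨ρ / 4, by positivity, (ball_subset_ball (by linarith)).trans hρΩ, ?_, ?_⟩
    · rw [Metric.uniformCauchySeqOn_iff]
      intro ε hε
      obtain ⟨N, hN⟩ := hFc (ε / (C + 1)) (by positivity)
      refine ⟨N, fun k hk m hm w hw => ?_⟩
      have h1 := hval k m w (ball_subset_ball (by linarith) hw)
      have h2 := hN k hk m hm
      rw [dist_eq_norm, lt_div_iff₀ (by positivity)] at h2
      rw [dist_eq_norm]
      nlinarith [norm_nonneg (F k - F m)]
    · rw [Metric.uniformCauchySeqOn_iff]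
      intro ε hε
      obtain ⟨N, hN⟩ := hFc (ε * (ρ / 4) / (2 * (C + 1))) (by positivity)
      refine ⟨N, fun k hk m hm w hw => ?_⟩
      have h1 := hder k m w hw
      have h2 := hN k hk m hm
      rw [dist_eq_norm, lt_div_iff₀ (by positivity)] at h2
      rw [le_div_iff₀ (by positivity)] at h1
      rw [dist_eq_norm]
      have h3 : 0 < ρ / 4 := by positivity
      by_contra! h4
      nlinarith [norm_nonneg (F k - F m)]
  have hlim : ∀ z ∈ Ω, Tendsto (fun k => g k z) atTop (𝓝 (limUnder atTop fun k => g k z)) := by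
    intro z hz
    obtain ⟨s, hs, -, h, -⟩ := hbd z hz
    exact (h.cauchySeq (mem_ball_self hs)).tendsto_limUnder
  refine ⟨fun z => limUnder atTop fun k => g k z, ?_, ?_⟩
  · intro z hz
    obtain ⟨s, hs, hsΩ, -, h⟩ := hbd z hz
    have hlim' : ∀ w ∈ ball z s, Tendsto (fun k => fderiv ℂ (g k) w) atTop
        (𝓝 (limUnder atTop fun k => fderiv ℂ (g k) w)) := fun w hw =>
      (h.cauchySeq hw).tendsto_limUnder
    have hu := h.tendstoUniformlyOn_of_tendsto hlim'
    exact (hasFDerivAt_of_tendstoUniformlyOn isOpen_ball hu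
      (fun k w hw => ((hg k).differentiableAt (hΩ.mem_nhds (hsΩ hw))).hasFDerivAt)
      (fun w hw => hlim w (hsΩ hw)) (mem_ball_self hs)).differentiableAt.differentiableWithinAt
  · obtain ⟨ns, hns, hae⟩ := (tendstoInMeasure_of_tendsto_Lp hFf).exists_seq_tendsto_ae
    filter_upwards [hae, ae_all_iff.2 hFg, ae_restrict_mem hΩ.measurableSet] with x h1 h2 h3
    refine tendsto_nhds_unique h1 ?_
    simp_rw [h2]
    exact (hlim x h3).comp hns.tendsto_atTop

/-- The open unit polydisc `𝔻ⁿ` in `ℂⁿ`. -/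
def polydisc (n : ℕ) : Set (Fin n → ℂ) := {z | ∀ j, ‖z j‖ < 1}

theorem isOpen_polydisc (n : ℕ) : IsOpen (polydisc n) := by
  have : polydisc n = ⋂ j, {z : Fin n → ℂ | ‖z j‖ < 1} := by
    ext z; simp [polydisc]
  rw [this]
  exact isOpen_iInter_of_finite fun j => isOpen_lt (by fun_prop) continuous_const

instance (n : ℕ) : CompleteSpace (bergmanSpace (polydisc n)) :=
  (isClosed_bergmanSpace (isOpen_polydisc n)).completeSpace_coe

theorem memLp_top_symbol {n : ℕ} {Ω : Set (Fin n → ℂ)} (hΩ : IsOpen Ω) {φ : (Fin n → ℂ) → ℂ}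
    (hφ : DifferentiableOn ℂ φ Ω) (hb : ∃ C : ℝ, ∀ z ∈ Ω, ‖φ z‖ ≤ C) :
    MemLp φ ∞ ((volume : Measure (Fin n → ℂ)).restrict Ω) := by
  obtain ⟨C, hC⟩ := hb
  refine memLp_top_of_bound (hφ.continuousOn.aestronglyMeasurable hΩ.measurableSet) C ?_
  filter_upwards [ae_restrict_mem hΩ.measurableSet] with z hz using hC z hz

/-- The Toeplitz operator `T_φ f = φ · f` on `A²(Ω)`, for `Ω` open and `φ` bounded and
holomorphic on `Ω`. -/
def toeplitz {n : ℕ} {Ω : Set (Fin n → ℂ)} (hΩ : IsOpen Ω) (φ : (Fin n → ℂ) → ℂ)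
    (hφ : DifferentiableOn ℂ φ Ω) (hb : ∃ C : ℝ, ∀ z ∈ Ω, ‖φ z‖ ≤ C) :
    bergmanSpace Ω →L[ℂ] bergmanSpace Ω :=
  (((ContinuousLinearMap.mul ℂ ℂ).holderL (volume.restrict Ω) ∞ 2 2
      (memLp_top_symbol hΩ hφ hb).toLp) ∘L (bergmanSpace Ω).subtypeL).codRestrict (bergmanSpace Ω)
    (by
      rintro ⟨f, g, hg, hfg⟩
      refine ⟨φ * g, hφ.mul hg, ?_⟩
      refine (ContinuousLinearMap.coeFn_holder _ _ _).trans ?_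
      filter_upwards [hfg, (memLp_top_symbol hΩ hφ hb).coeFn_toLp] with z h1 h2
      simp [h1, h2])

/-- The defining property of `toeplitz`: it is multiplication by `φ`. -/
theorem coeFn_toeplitz {n : ℕ} {Ω : Set (Fin n → ℂ)} (hΩ : IsOpen Ω) (φ : (Fin n → ℂ) → ℂ)
    (hφ : DifferentiableOn ℂ φ Ω) (hb : ∃ C : ℝ, ∀ z ∈ Ω, ‖φ z‖ ≤ C) (f : bergmanSpace Ω) :
    (toeplitz hΩ φ hφ hb f : Lp ℂ 2 ((volume : Measure (Fin n → ℂ)).restrict Ω))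
      =ᵐ[volume.restrict Ω] fun z => φ z * (f : Lp ℂ 2 (volume.restrict Ω)) z := by
  refine (ContinuousLinearMap.coeFn_holder (ContinuousLinearMap.mul ℂ ℂ) _ _).trans ?_
  filter_upwards [(memLp_top_symbol hΩ hφ hb).coeFn_toLp] with z h2
  simp [h2]

/-- The linear function `φ(z) = ∑ⱼ aⱼ zⱼ`. -/
def linearSymbol {n : ℕ} (a : Fin n → ℂ) (z : Fin n → ℂ) : ℂ := ∑ j, a j * z j

theorem differentiable_linearSymbol {n : ℕ} (a : Fin n → ℂ) :
    Differentiable ℂ (linearSymbol a) := by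
  unfold linearSymbol; fun_prop

theorem linearSymbol_bounded {n : ℕ} (a : Fin n → ℂ) :
    ∃ C : ℝ, ∀ z ∈ polydisc n, ‖linearSymbol a z‖ ≤ C := by
  refine ⟨∑ j, ‖a j‖, fun z hz => (norm_sum_le _ _).trans (Finset.sum_le_sum fun j _ => ?_)⟩
  rw [norm_mul]
  exact mul_le_of_le_one_right (norm_nonneg _) (hz j).le

/-- `T_φ` on `A²(𝔻ⁿ)` with the linear symbol `φ(z) = ∑ⱼ aⱼ zⱼ`. -/
def polydiscToeplitz {n : ℕ} (a : Fin n → ℂ) :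
    bergmanSpace (polydisc n) →L[ℂ] bergmanSpace (polydisc n) :=
  toeplitz (isOpen_polydisc n) (linearSymbol a) (differentiable_linearSymbol a).differentiableOn
    (linearSymbol_bounded a)

/-- The self-commutator `[T*, T] = T* T - T T*` of a bounded operator on a Hilbert space. -/
def selfCommutator {H : Type*} [NormedAddCommGroup H] [InnerProductSpace ℂ H] [CompleteSpace H]
    (T : H →L[ℂ] H) : H →L[ℂ] H :=
  ContinuousLinearMap.adjoint T ∘L T - T ∘L ContinuousLinearMap.adjoint T

end

/-!
The three assertions have independent proofs. Write `s = ∑ⱼ |aⱼ|` and `S = ∑ⱼ |aⱼ|²`.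

*Spectrum.* Since `|φ| ≤ s` on the polydisc, `‖T_φ‖ ≤ s`, and the spectrum lies in the closed disc
of radius `s`. Conversely, for `w` in the polydisc, the range of `φ(w) - T_φ` consists of functions
vanishing at `w`, so it misses the constant `1`, and `φ(w)` is in the spectrum
(`linearSymbol_mem_spectrum`). Choosing the arguments of the `wⱼ` opposite to those of the `aⱼ`
shows that `φ` maps the closed polydisc onto the closed disc of radius `s`
(`exists_linearSymbol_eq`); the spectrum being closed, it is the whole disc.

*Upper bound.* `⟨[T*, T] f, f⟩ = ‖T f‖² - ‖T* f‖²` has absolute value at most `‖T‖² ‖f‖²`, so the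
self-adjoint operator `[T*, T]` has norm at most `‖T‖² ≤ s²` (`norm_selfCommutator_le`), and
`s² ≤ n S` by the Cauchy–Schwarz inequality.

*Lower bound.* The same quadratic form is evaluated at `f = 1`. Here `T_φ* 1 = 0` by the mean value
property (`adjoint_polydiscToeplitz_bergmanOne`), while `‖T_φ 1‖² = ‖φ‖² = (S / 2) ‖1‖²` because the
coordinate functions are orthogonal with `‖zⱼ‖² = ‖1‖² / 2`. Hence `‖[T_φ*, T_φ]‖ ≥ S / 2`, which is
at least `(3 / 4)ⁿ⁻¹ S / 2 = 3ⁿ⁻¹ / 2²ⁿ⁻¹ S`.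
-/

open scoped ComplexConjugate

/-! ### The self-commutator of a bounded operator -/

theorem reApplyInnerSelf_selfCommutator {H : Type*} [NormedAddCommGroup H]
    [InnerProductSpace ℂ H] [CompleteSpace H] (T : H →L[ℂ] H) (x : H) :
    (selfCommutator T).reApplyInnerSelf x =
      ‖T x‖ ^ 2 - ‖ContinuousLinearMap.adjoint T x‖ ^ 2 := by
  rw [ContinuousLinearMap.reApplyInnerSelf_apply, selfCommutator, sub_apply,
    inner_sub_left, map_sub]
  rw [ContinuousLinearMap.comp_apply, ContinuousLinearMap.comp_apply,
    ContinuousLinearMap.adjoint_inner_left, ← ContinuousLinearMap.adjoint_inner_right T _ x,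
    inner_self_eq_norm_sq (𝕜 := ℂ), inner_self_eq_norm_sq (𝕜 := ℂ)]

/-- `T* T` and `T T*` both lie between `0` and `‖T‖²`, so the quadratic form of their difference is
bounded by `‖T‖²`; for a self-adjoint operator that bounds the norm. -/
theorem norm_selfCommutator_le {H : Type*} [NormedAddCommGroup H]
    [InnerProductSpace ℂ H] [CompleteSpace H] (T : H →L[ℂ] H) :
    ‖selfCommutator T‖ ≤ ‖T‖ ^ 2 := by
  have hsa : IsSelfAdjoint (selfCommutator T) :=
    (IsSelfAdjoint.star_mul_self T).sub (IsSelfAdjoint.mul_star_self T)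
  rw [ContinuousLinearMap.norm_eq_iSup_rayleighQuotient _ hsa.isSymmetric]
  refine ciSup_le fun x => ?_
  have h1 : ‖T x‖ ^ 2 ≤ ‖T‖ ^ 2 * ‖x‖ ^ 2 := by
    rw [← mul_pow]; gcongr; exact T.le_opNorm x
  have h2 : ‖ContinuousLinearMap.adjoint T x‖ ^ 2 ≤ ‖T‖ ^ 2 * ‖x‖ ^ 2 := by
    rw [← mul_pow, ← LinearIsometryEquiv.norm_map ContinuousLinearMap.adjoint T]
    gcongr; exact ContinuousLinearMap.le_opNorm _ x
  rw [ContinuousLinearMap.rayleighQuotient, reApplyInnerSelf_selfCommutator, abs_div,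
    abs_of_nonneg (sq_nonneg ‖x‖)]
  refine div_le_of_le_mul₀ (sq_nonneg _) (sq_nonneg _) (abs_le.2 ⟨?_, ?_⟩)
  · nlinarith [sq_nonneg ‖T x‖]
  · nlinarith [sq_nonneg ‖ContinuousLinearMap.adjoint T x‖]

theorem norm_le_opNorm_of_mem_spectrum {H : Type*} [NormedAddCommGroup H] [NormedSpace ℂ H]
    [CompleteSpace H] [Nontrivial H] (T : H →L[ℂ] H) {μ : ℂ} (hμ : μ ∈ spectrum ℂ T) :
    ‖μ‖ ≤ ‖T‖ :=
  spectrum.norm_le_norm_of_mem hμ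

/-! ### Integration over the polydisc -/

theorem polydisc_eq_pi (n : ℕ) : polydisc n = Set.univ.pi fun _ => ball (0 : ℂ) 1 := by
  ext z; simp [polydisc]

theorem smul_mem_polydisc {n : ℕ} {z : Fin n → ℂ} (hz : z ∈ polydisc n) {c : ℂ} (hc : ‖c‖ ≤ 1) :
    c • z ∈ polydisc n := fun j => by
  rw [Pi.smul_apply, smul_eq_mul, norm_mul]
  exact (mul_le_of_le_one_left (norm_nonneg _) hc).trans_lt (hz j)

theorem preimage_smul_polydisc {n : ℕ} {c : ℂ} (hc : ‖c‖ = 1) :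
    (fun z : Fin n → ℂ => c • z) ⁻¹' polydisc n = polydisc n := by
  ext z; simp [polydisc, hc]

theorem restrict_polydisc (n : ℕ) :
    (volume : Measure (Fin n → ℂ)).restrict (polydisc n) =
      Measure.pi fun _ => (volume : Measure ℂ).restrict (ball 0 1) := by
  rw [polydisc_eq_pi, volume_pi, Measure.restrict_pi_pi]

instance (n : ℕ) : IsFiniteMeasure ((volume : Measure (Fin n → ℂ)).restrict (polydisc n)) := by
  have : IsFiniteMeasure ((volume : Measure ℂ).restrict (ball 0 1)) :=
    isFiniteMeasure_restrict.2 measure_ball_lt_top.ne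
  rw [restrict_polydisc]; infer_instance

theorem volume_real_unitDisc : (volume : Measure ℂ).real (ball 0 1) = Real.pi := by
  simp [measureReal_def, Complex.volume_ball]

theorem volume_real_polydisc (n : ℕ) :
    (volume : Measure (Fin n → ℂ)).real (polydisc n) = Real.pi ^ n := by
  rw [measureReal_def, polydisc_eq_pi, volume_pi_pi]
  simp [Complex.volume_ball]

/-- The mean value property: averaging over the rotations `z ↦ e^{iθ} z` reduces it to the mean
value property on circles, and these rotations preserve Lebesgue measure on the polydisc. -/
theorem setIntegral_polydisc_eq {n : ℕ} {g : (Fin n → ℂ) → ℂ}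
    (hg : DifferentiableOn ℂ g (polydisc n)) (hi : IntegrableOn g (polydisc n)) :
    ∫ z in polydisc n, g z = Real.pi ^ n * g 0 := by
  set μ : Measure (Fin n → ℂ) := volume.restrict (polydisc n) with hμ
  set ν : Measure ℝ := volume.restrict (Set.Ioc 0 (2 * Real.pi)) with hν
  have hνu : ν.real Set.univ = 2 * Real.pi := by
    simp [hν, measureReal_def, Real.pi_pos.le]
  have hrot : ∀ θ : ℝ, MeasurePreserving (fun v : Fin n → ℂ => circleMap 0 1 θ • v) μ μ := by
    intro θ
    have h := (measurePreserving_rot n (circleMap 0 1 θ) (by simp)).restrict_preimage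
      (isOpen_polydisc n).measurableSet
    rwa [preimage_smul_polydisc (by simp)] at h
  have hskew : MeasurePreserving
      (fun p : ℝ × (Fin n → ℂ) => (p.1, circleMap 0 1 p.1 • p.2)) (ν.prod μ) (ν.prod μ) := by
    refine (MeasurePreserving.id ν).skew_product ?_ (ae_of_all _ fun θ => (hrot θ).map_eq)
    refine Continuous.measurable ?_
    have := continuous_circleMap 0 1
    fun_prop
  have hint : Integrable (fun p : ℝ × (Fin n → ℂ) => g (circleMap 0 1 p.1 • p.2)) (ν.prod μ) :=
    hskew.integrable_comp_of_integrable (hi.comp_snd ν)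
  have hcircle : ∀ z ∈ polydisc n,
      ∫ θ, g (circleMap 0 1 θ • z) ∂ν = (2 * Real.pi : ℝ) • g 0 := by
    intro z hz
    have hd : DifferentiableOn ℂ (fun ζ : ℂ => g (ζ • z)) (closedBall 0 1) :=
      hg.comp (by fun_prop) fun ζ hζ => smul_mem_polydisc hz (by simpa using hζ)
    have hm : Real.circleAverage (fun ζ : ℂ => g (ζ • z)) 0 1 = g 0 := by
      have : DiffContOnCl ℂ (fun ζ : ℂ => g (ζ • z)) (ball 0 |1|) := by
        refine DifferentiableOn.diffContOnCl ?_
        simpa [closure_ball] using hd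
      simpa using this.circleAverage
    rw [← hm, Real.circleAverage_def, smul_inv_smul₀ (by positivity),
      intervalIntegral.integral_of_le (by positivity)]
  have h1 : ∫ θ, ∫ z, g (circleMap 0 1 θ • z) ∂μ ∂ν = (2 * Real.pi : ℝ) • ∫ z, g z ∂μ := by
    have : ∀ θ, ∫ z, g (circleMap 0 1 θ • z) ∂μ = ∫ z, g z ∂μ := fun θ =>
      (hrot θ).integral_comp
        (measurableEmbedding_const_smul₀ (c := circleMap 0 1 θ) (by simp)) g
    simp_rw [this]
    rw [integral_const, hνu]
  have h2 : ∫ z, ∫ θ, g (circleMap 0 1 θ • z) ∂ν ∂μ = (2 * Real.pi : ℝ) • (Real.pi ^ n * g 0) := by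
    rw [integral_congr_ae (g := fun _ => (2 * Real.pi : ℝ) • g 0), integral_const, hμ,
      measureReal_restrict_apply_univ, volume_real_polydisc, smul_comm]
    · simp
    · filter_upwards [ae_restrict_mem (isOpen_polydisc n).measurableSet] with z hz using hcircle z hz
  rw [integral_integral_swap hint, h2] at h1
  exact (smul_right_injective ℂ (by positivity : (2 * Real.pi : ℝ) ≠ 0) h1).symm

theorem setIntegral_unitDisc_id : ∫ z in ball (0 : ℂ) 1, z = 0 := by
  have h := integral_neg_eq_self ((ball (0 : ℂ) 1).indicator fun z => z) volume
  have h2 : ∀ z : ℂ, (ball (0 : ℂ) 1).indicator (fun z => z) (-z) =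
      -(ball (0 : ℂ) 1).indicator (fun z => z) z := by
    intro z; by_cases hz : ‖z‖ < 1 <;> simp [Set.indicator, hz]
  simp_rw [h2, integral_neg] at h
  rw [← integral_indicator measurableSet_ball]
  exact self_eq_neg.1 h.symm

theorem setIntegral_unitDisc_mul_conj :
    ∫ z in ball (0 : ℂ) 1, z * conj z = (Real.pi * (1 / 2) : ℂ) := by
  have h := integral_fun_norm_addHaar (volume : Measure ℂ)
    ((Set.Iio (1 : ℝ)).indicator fun r => r ^ 2)
  have h2 : ∫ r in Set.Ioi (0 : ℝ), r ^ (Module.finrank ℝ ℂ - 1) •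
      (Set.Iio (1 : ℝ)).indicator (fun r => r ^ 2) r = 1 / 4 := by
    have : ∀ r : ℝ, r ^ (Module.finrank ℝ ℂ - 1) • (Set.Iio (1 : ℝ)).indicator (fun r => r ^ 2) r
        = (Set.Iio (1 : ℝ)).indicator (fun r => r ^ 3) r := by
      intro r
      by_cases hr : r < 1 <;> simp [Set.indicator, hr]; ring
    simp_rw [this]
    rw [setIntegral_indicator measurableSet_Iio, Set.Ioi_inter_Iio,
      ← integral_Ioc_eq_integral_Ioo, ← intervalIntegral.integral_of_le zero_le_one, integral_pow]
    norm_num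
  rw [h2, volume_real_unitDisc] at h
  have h3 : ∀ z : ℂ, (Set.Iio (1 : ℝ)).indicator (fun r => r ^ 2) ‖z‖ =
      (ball (0 : ℂ) 1).indicator (fun z => ‖z‖ ^ 2) z := by
    intro z; by_cases hz : ‖z‖ < 1 <;> simp [Set.indicator, hz]
  simp_rw [h3] at h
  rw [integral_indicator measurableSet_ball] at h
  simp_rw [Complex.mul_conj']
  have h4 : ∫ z in ball (0 : ℂ) 1, ((‖z‖ : ℂ) ^ 2) =
      ((∫ z in ball (0 : ℂ) 1, ‖z‖ ^ 2 : ℝ) : ℂ) := by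
    rw [← integral_complex_ofReal]; simp
  rw [h4, h]
  simp
  ring

/-- The coordinate functions are orthogonal in `A²(𝔻ⁿ)`, with `‖zⱼ‖² = πⁿ / 2`. -/
theorem setIntegral_polydisc_mul_conj {n : ℕ} (j k : Fin n) :
    ∫ z in polydisc n, z j * conj (z k) = if j = k then (Real.pi ^ n * (1 / 2) : ℂ) else 0 := by
  have h := integral_fintype_prod_eq_prod (𝕜 := ℂ)
    (μ := fun _ : Fin n => (volume : Measure ℂ).restrict (ball 0 1))
    (fun i z => (if i = j then z else 1) * (if i = k then conj z else 1))
  simp only [Finset.prod_mul_distrib, Finset.prod_ite_eq', Finset.mem_univ, if_true] at h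
  rw [restrict_polydisc, h]
  split_ifs with hjk
  · subst hjk
    have : ∀ i : Fin n, ∫ z in ball (0 : ℂ) 1,
        (if i = j then z else 1) * (if i = j then conj z else 1) =
        (Real.pi : ℂ) * if i = j then (1 / 2) else 1 := by
      intro i
      by_cases hi : i = j
      · simpa [hi] using setIntegral_unitDisc_mul_conj
      · simp [hi, volume_real_unitDisc]
    simp_rw [this, Finset.prod_mul_distrib]
    simp
  · refine Finset.prod_eq_zero (Finset.mem_univ j) ?_
    simpa [hjk] using setIntegral_unitDisc_id

theorem setIntegral_polydisc_linearSymbol_mul_conj {n : ℕ} (a : Fin n → ℂ) :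
    ∫ z in polydisc n, linearSymbol a z * conj (linearSymbol a z) =
      ((Real.pi ^ n * ((∑ j, ‖a j‖ ^ 2) / 2) : ℝ) : ℂ) := by
  have hb : ∀ j k, Integrable (fun z : Fin n → ℂ => z j * conj (z k))
      (volume.restrict (polydisc n)) := by
    intro j k
    refine Integrable.of_bound (C := 1) (Continuous.aestronglyMeasurable (by fun_prop)) ?_
    filter_upwards [ae_restrict_mem (isOpen_polydisc n).measurableSet] with z hz
    rw [norm_mul, RCLike.norm_conj]
    exact mul_le_one₀ (hz j).le (norm_nonneg _) (hz k).le
  have he : ∀ z : Fin n → ℂ, linearSymbol a z * conj (linearSymbol a z) =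
      ∑ j, ∑ k, (a j * conj (a k)) * (z j * conj (z k)) := by
    intro z
    rw [linearSymbol, map_sum, Finset.sum_mul_sum]
    refine Finset.sum_congr rfl fun j _ => Finset.sum_congr rfl fun k _ => ?_
    rw [map_mul]; ring
  simp_rw [he]
  rw [integral_finsetSum _ fun j _ => integrable_finsetSum _ fun k _ => (hb j k).const_mul _]
  simp_rw [integral_finsetSum _ fun k _ => (hb _ k).const_mul _, integral_const_mul,
    setIntegral_polydisc_mul_conj, mul_ite, mul_zero, Finset.sum_ite_eq, Finset.mem_univ, if_true,
    Complex.mul_conj']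
  push_cast
  rw [← Finset.sum_mul]; ring

/-! ### The constant function in the Bergman space -/

/-- The constant function `1`, as an element of `A²(𝔻ⁿ)`. -/
noncomputable def bergmanOne (n : ℕ) : bergmanSpace (polydisc n) :=
  ⟨(memLp_const (1 : ℂ)).toLp (fun _ => 1), fun _ => 1, differentiableOn_const 1,
    MemLp.coeFn_toLp (memLp_const 1)⟩

theorem coeFn_bergmanOne (n : ℕ) :
    ((bergmanOne n : Lp ℂ 2 (volume.restrict (polydisc n))) : (Fin n → ℂ) → ℂ)
      =ᵐ[volume.restrict (polydisc n)] fun _ => 1 := MemLp.coeFn_toLp (memLp_const 1)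

theorem coeFn_polydiscToeplitz {n : ℕ} (a : Fin n → ℂ) (f : bergmanSpace (polydisc n)) :
    (polydiscToeplitz a f : Lp ℂ 2 ((volume : Measure (Fin n → ℂ)).restrict (polydisc n)))
      =ᵐ[volume.restrict (polydisc n)]
      fun z => linearSymbol a z * (f : Lp ℂ 2 (volume.restrict (polydisc n))) z :=
  coeFn_toeplitz _ _ _ _ f

theorem norm_bergmanOne_sq (n : ℕ) : ‖bergmanOne n‖ ^ 2 = Real.pi ^ n := by
  have h := inner_self_eq_norm_sq_to_K (𝕜 := ℂ) (bergmanOne n)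
  rw [Submodule.coe_inner, L2.inner_def, integral_congr_ae (g := fun _ => (1 : ℂ))] at h
  · rw [integral_const, measureReal_restrict_apply_univ, volume_real_polydisc,
      Complex.real_smul, mul_one] at h
    exact Complex.ofReal_injective (by simpa using h.symm)
  · filter_upwards [coeFn_bergmanOne n] with z hz
    simp [hz]

theorem bergmanOne_ne_zero (n : ℕ) : bergmanOne n ≠ 0 := by
  intro h
  have h1 := norm_bergmanOne_sq n
  rw [h, norm_zero, zero_pow two_ne_zero] at h1
  exact (pow_pos Real.pi_pos n).ne h1

theorem norm_polydiscToeplitz_bergmanOne_sq {n : ℕ} (a : Fin n → ℂ) :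
    ‖polydiscToeplitz a (bergmanOne n)‖ ^ 2 = Real.pi ^ n * ((∑ j, ‖a j‖ ^ 2) / 2) := by
  have h := inner_self_eq_norm_sq_to_K (𝕜 := ℂ) (polydiscToeplitz a (bergmanOne n))
  rw [Submodule.coe_inner, L2.inner_def,
    integral_congr_ae (g := fun z => linearSymbol a z * conj (linearSymbol a z)),
    setIntegral_polydisc_linearSymbol_mul_conj] at h
  · exact Complex.ofReal_injective (by simpa using h.symm)
  · filter_upwards [coeFn_bergmanOne n, coeFn_polydiscToeplitz a (bergmanOne n)] with z h1 h2
    rw [h2, h1, mul_one, RCLike.inner_apply]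

/-- `T_φ* 1 = 0`, since `⟨1, φ f⟩` is a multiple of `φ(0) f(0) = 0` by the mean value property. -/
theorem adjoint_polydiscToeplitz_bergmanOne {n : ℕ} (a : Fin n → ℂ) :
    ContinuousLinearMap.adjoint (polydiscToeplitz a) (bergmanOne n) = 0 := by
  refine ext_inner_right ℂ fun f => ?_
  rw [ContinuousLinearMap.adjoint_inner_left, inner_zero_left, Submodule.coe_inner, L2.inner_def]
  obtain ⟨g, hg, hfg⟩ := f.2
  have hae : (polydiscToeplitz a f : Lp ℂ 2 ((volume : Measure (Fin n → ℂ)).restrict (polydisc n)))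
      =ᵐ[volume.restrict (polydisc n)] fun z => linearSymbol a z * g z := by
    filter_upwards [hfg, coeFn_polydiscToeplitz a f] with z h1 h2
    rw [h2, h1]
  have hi : IntegrableOn (fun z => linearSymbol a z * g z) (polydisc n) :=
    (((Lp.memLp _).integrable (by norm_num)).congr hae)
  have hm := setIntegral_polydisc_eq (g := fun z => linearSymbol a z * g z)
    ((differentiable_linearSymbol a).differentiableOn.mul hg) hi
  have h0 : linearSymbol a 0 = 0 := by simp [linearSymbol]
  simp only [h0, zero_mul, mul_zero] at hm
  rw [← hm]
  refine integral_congr_ae ?_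
  filter_upwards [coeFn_bergmanOne n, hae] with z h1 h2
  simp [h1, h2]

/-- Testing the quadratic form of the self-commutator on the constant function `1`. -/
theorem half_sum_sq_le_norm_selfCommutator {n : ℕ} (a : Fin n → ℂ) :
    (∑ j, ‖a j‖ ^ 2) / 2 ≤ ‖selfCommutator (polydiscToeplitz a)‖ := by
  refine le_trans ?_ ((selfCommutator (polydiscToeplitz a)).rayleighQuotient_le_norm (bergmanOne n))
  rw [ContinuousLinearMap.rayleighQuotient, reApplyInnerSelf_selfCommutator,
    adjoint_polydiscToeplitz_bergmanOne, norm_polydiscToeplitz_bergmanOne_sq, norm_bergmanOne_sq,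
    norm_zero, zero_pow two_ne_zero, sub_zero, mul_div_cancel_left₀ _ (by positivity)]
  exact le_abs_self _

/-! ### Norm and spectrum of the Toeplitz operator -/

theorem norm_linearSymbol_le {n : ℕ} (a : Fin n → ℂ) {z : Fin n → ℂ} (hz : z ∈ polydisc n) :
    ‖linearSymbol a z‖ ≤ ∑ j, ‖a j‖ :=
  (norm_sum_le _ _).trans <| Finset.sum_le_sum fun j _ => by
    rw [norm_mul]; exact mul_le_of_le_one_right (norm_nonneg _) (hz j).le

theorem norm_polydiscToeplitz_le {n : ℕ} (a : Fin n → ℂ) :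
    ‖polydiscToeplitz a‖ ≤ ∑ j, ‖a j‖ := by
  refine ContinuousLinearMap.opNorm_le_bound _ (by positivity) fun f => ?_
  have h : ∀ᵐ z ∂volume.restrict (polydisc n),
      ‖(polydiscToeplitz a f : Lp ℂ 2 (volume.restrict (polydisc n))) z‖ ≤
        (∑ j, ‖a j‖) * ‖(f : Lp ℂ 2 (volume.restrict (polydisc n))) z‖ := by
    filter_upwards [coeFn_polydiscToeplitz a f, ae_restrict_mem (isOpen_polydisc n).measurableSet]
      with z h1 hz
    rw [h1, norm_mul]
    gcongr
    exact norm_linearSymbol_le a hz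
  exact Lp.norm_le_mul_norm_of_ae_le_mul h

/-- Every value `φ(w)` of the symbol lies in the spectrum: the range of `φ(w) - T_φ` consists of
functions vanishing at `w`, so it does not contain `1`. -/
theorem linearSymbol_mem_spectrum {n : ℕ} (a : Fin n → ℂ) {w : Fin n → ℂ} (hw : w ∈ polydisc n) :
    linearSymbol a w ∈ spectrum ℂ (polydiscToeplitz a) := by
  rw [spectrum.mem_iff]
  rintro ⟨u, hu⟩
  set f : bergmanSpace (polydisc n) := (↑u⁻¹ : _ →L[ℂ] _) (bergmanOne n)
  have hf : linearSymbol a w • f - polydiscToeplitz a f = bergmanOne n := by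
    have h := congrArg (fun A : bergmanSpace (polydisc n) →L[ℂ] _ => A (bergmanOne n)) u.mul_inv
    rw [hu] at h
    simpa [Algebra.algebraMap_eq_smul_one, f] using h
  obtain ⟨g, hg, hfg⟩ := f.2
  have hae : (fun z => linearSymbol a w * g z - linearSymbol a z * g z)
      =ᵐ[volume.restrict (polydisc n)] fun _ => 1 := by
    have hf' := congrArg (Subtype.val) hf
    rw [Submodule.coe_sub, Submodule.coe_smul] at hf'
    have h1 := coeFn_bergmanOne n
    rw [← hf'] at h1
    filter_upwards [h1, hfg, coeFn_polydiscToeplitz a f,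
      Lp.coeFn_sub (linearSymbol a w • (f : Lp ℂ 2 (volume.restrict (polydisc n))))
        (polydiscToeplitz a f : Lp ℂ 2 (volume.restrict (polydisc n))),
      Lp.coeFn_smul (linearSymbol a w) (f : Lp ℂ 2 (volume.restrict (polydisc n)))]
      with z h1 h2 h3 h4 h5
    rw [← h1, h4, Pi.sub_apply, h5, h3, Pi.smul_apply, smul_eq_mul, h2]
  have hc := (differentiable_linearSymbol a).continuous.continuousOn (s := polydisc n)
  have heq := Measure.eqOn_open_of_ae_eq hae (isOpen_polydisc n)
    ((continuousOn_const.mul hg.continuousOn).sub (hc.mul hg.continuousOn)) continuousOn_const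
  simpa using heq hw

/-- The symbol maps the closed polydisc onto the closed disc of radius `∑ⱼ |aⱼ|`. -/
theorem exists_linearSymbol_eq {n : ℕ} (a : Fin n → ℂ) {μ : ℂ} (hμ : ‖μ‖ ≤ ∑ j, ‖a j‖) :
    ∃ w : Fin n → ℂ, (∀ j, ‖w j‖ ≤ 1) ∧ linearSymbol a w = μ := by
  have hs0 : 0 ≤ ∑ j, ‖a j‖ := Finset.sum_nonneg fun j _ => norm_nonneg _
  -- Divisions by `0` are read as `0`: then `wⱼ = 0` where `aⱼ = 0`, and `w = 0` if `a = 0`.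
  refine ⟨fun j => μ / (∑ j, ‖a j‖ : ℝ) * (conj (a j) / ‖a j‖), fun j => ?_, ?_⟩
  · rw [norm_mul, norm_div, norm_div, RCLike.norm_conj, Complex.norm_real, Complex.norm_real,
      norm_norm, Real.norm_of_nonneg hs0]
    exact mul_le_one₀ (div_le_one_of_le₀ hμ hs0) (by positivity) (div_self_le_one _)
  · have h1 : ∀ j, a j * (conj (a j) / ‖a j‖) = ‖a j‖ := fun j => by
      rw [← mul_div_assoc, Complex.mul_conj', sq, mul_self_div_self]
    have h2 : μ / (∑ j, ‖a j‖ : ℝ) * (∑ j, ‖a j‖ : ℝ) = μ := by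
      refine div_mul_cancel_of_imp fun h => ?_
      rw [Complex.ofReal_eq_zero.1 h] at hμ
      exact norm_le_zero_iff.1 hμ
    simp_rw [linearSymbol, mul_left_comm (a _), h1]
    rw [← Finset.mul_sum, ← Complex.ofReal_sum, h2]

theorem linearSymbol_smul {n : ℕ} (a : Fin n → ℂ) (c : ℂ) (z : Fin n → ℂ) :
    linearSymbol a (c • z) = c * linearSymbol a z := by
  simp [linearSymbol, Finset.mul_sum, mul_left_comm]

theorem spectrum_polydiscToeplitz {n : ℕ} (a : Fin n → ℂ) :
    spectrum ℂ (polydiscToeplitz a) = closedBall 0 (∑ j, ‖a j‖) := by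
  refine subset_antisymm (fun μ hμ => ?_) fun μ hμ => ?_
  · have : Nontrivial (bergmanSpace (polydisc n)) := ⟨bergmanOne n, 0, bergmanOne_ne_zero n⟩
    rw [mem_closedBall_zero_iff]
    exact (norm_le_opNorm_of_mem_spectrum _ hμ).trans (norm_polydiscToeplitz_le a)
  · obtain ⟨w, hw, rfl⟩ := exists_linearSymbol_eq a (mem_closedBall_zero_iff.1 hμ)
    -- The points `t w` with `0 < t < 1` lie in the open polydisc, and the spectrum is closed.
    have hlim : Tendsto (fun t : ℝ => (t : ℂ) * linearSymbol a w) (𝓝[<] 1)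
        (𝓝 (linearSymbol a w)) := by
      have : Continuous fun t : ℝ => (t : ℂ) * linearSymbol a w := by fun_prop
      simpa using (this.tendsto 1).mono_left nhdsWithin_le_nhds
    refine (spectrum.isClosed (𝕜 := ℂ) (polydiscToeplitz a)).mem_of_tendsto hlim ?_
    filter_upwards [Ioo_mem_nhdsLT (zero_lt_one' ℝ)] with t ht
    rw [← linearSymbol_smul]
    refine linearSymbol_mem_spectrum a fun j => ?_
    rw [Pi.smul_apply, norm_smul, Complex.norm_real, Real.norm_of_nonneg ht.1.le]
    exact (mul_le_of_le_one_right ht.1.le (hw j)).trans_lt ht.2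

/-! ### The spectrum and the self-commutator for a linear symbol -/

theorem mainTheorem4 (n : ℕ) (hn : 1 ≤ n) (a : Fin n → ℂ) :
    spectrum ℂ (polydiscToeplitz a) = Metric.closedBall (0 : ℂ) (∑ j, ‖a j‖) ∧
    (3 : ℝ) ^ (n - 1) / 2 ^ (2 * n - 1) * ∑ j, ‖a j‖ ^ 2 ≤ ‖selfCommutator (polydiscToeplitz a)‖ ∧
    ‖selfCommutator (polydiscToeplitz a)‖ ≤ (∑ j, ‖a j‖) ^ 2 ∧
    (∑ j, ‖a j‖) ^ 2 ≤ n * ∑ j, ‖a j‖ ^ 2 ∧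
    ‖selfCommutator (polydiscToeplitz a)‖ ≤ n * ∑ j, ‖a j‖ ^ 2 := by
  have hupper : ‖selfCommutator (polydiscToeplitz a)‖ ≤ (∑ j, ‖a j‖) ^ 2 :=
    (norm_selfCommutator_le _).trans
      (by gcongr; exact norm_polydiscToeplitz_le a)
  have hcs : (∑ j, ‖a j‖) ^ 2 ≤ n * ∑ j, ‖a j‖ ^ 2 := by
    simpa using sq_sum_le_card_mul_sum_sq (s := Finset.univ) (f := fun j => ‖a j‖)
  have hconst : (3 : ℝ) ^ (n - 1) / 2 ^ (2 * n - 1) ≤ 1 / 2 := by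
    obtain ⟨m, rfl⟩ := Nat.exists_eq_add_of_le' hn
    rw [div_le_div_iff₀ (by positivity) two_pos, Nat.add_sub_cancel,
      show 2 * (m + 1) - 1 = 2 * m + 1 by omega, pow_succ, pow_mul, one_mul]
    gcongr
    norm_num
  refine ⟨spectrum_polydiscToeplitz a, ?_, hupper, hcs, hupper.trans hcs⟩
  refine le_trans ?_ (half_sum_sq_le_norm_selfCommutator a)
  rw [div_eq_mul_one_div (∑ j, ‖a j‖ ^ 2), mul_comm (∑ j, ‖a j‖ ^ 2)]
  gcongr
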